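/- Let $m\ge 1$ and let $\sigma:\mathbb Z_m\to U(n)$ be a unitary representation; write $gx=\sigma(g)x$ for $x\in\mathbb C^n$, let $\mathbb C^n/\mathbb Z_m$ be the space of orbits $[x]$, and let $d_{\mathbb Z_m}([x],[y])=\min_{g}\|x-gy\|$ with the Euclidean norm. Then there is an orthonormal basis of $\mathbb C^n$ in which the generator $1\in\mathbb Z_m$ acts by a diagonal matrix $T=\mathrm{diag}(t_1,\dots,t_n)$ (so $t_i^m=1$). Fix any such basis and let $x_1,\dots,x_n$ denote the coordinates of $x$ in it. Let $m_i$ be the order of $t_i$; for $j<k$ let $a_{jk}$ be the least integer $a\geq 1$ such that $x_j^{a}x_k^{b}$ is $T$-invariant for some $0\le b<m_k$, and let $b_{jk}$ be the corresponding (unique) $b$. Put $$F_T(x)=\big((x_i^{m_i})_{1\le i\le n},\ (x_j^{a_{jk}}x_k^{b_{jk}})_{1\le j<k\le n}\big)\in\mathbb C^{n(n+1)/2}.$$ For a map $H:\mathbb C^n\to\mathbb C^{N}$ put $\Phi_H(x)=\|x\|\,H(x/\|x\|)$ for $x\ne0$ and $\Phi_H(0)=0$. For a linear map $\ell:\mathbb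 C^{n(n+1)/2}\to\mathbb C^{2n+1}$ let $\|\ell\|_{2\to2}$ be its operator norm for the Euclidean norms, and $\|\ell\|_{\infty\to 2}$ its operator norm when $\mathbb C^{n(n+1)/2}$ carries the maximum norm and $\mathbb C^{2n+1}$ the Euclidean norm. (a) For generic $\ell$ (that is, for all $\ell$ outside the zero set of some nonzero real polynomial in the real and imaginary parts of the matrix entries of $\ell$) the maps $\ell\circ F_T$ and $\Phi=\Phi_{\ell\circ F_T}:\mathbb C^n\to\mathbb C^{2n+1}$ are $\mathbb Z_m$-invariant, both induced maps $\mathbb C^n/\mathbb Z_m\to\mathbb C^{2n+1}$ are injective, and the map $\tilde\Phi$ induced by $\Phi$ satisfies $$\|\tilde\Phi([x])-\tilde\Phi([y])\|\le 3m\,\|\ell\|_{\infty\to2}\;d_{\mathbb Z_m}([x],[y])\qquad(x,y\in\mathbb C^n).$$ (b) There is a linear map $\ell$ with $\|\ell\|_{2\to 2}\le 1$ such that $\ell\circ F_T$ and $\Phi=\Phi_{\ell\circ F_T}$ are $\mathbb Z_m$-invariant, both induced maps are injective, and $$\|\tilde\Phi([x])-\tilde\Phi([y])\|\le 3m\,\|\ell\|_{2\to2}\;d_{\mathbb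 Z_m}([x],[y])\qquad(x,y\in\mathbb C^n);$$ in particular $\tilde\Phi$ is Lipschitz with the constant $3m$, which depends only on $m$. -/

import Mathlib

/-- `ℂⁿ` with its Euclidean norm. -/
abbrev CSpace (n : ℕ) : Type := EuclideanSpace ℂ (Fin n)

/-- A unitary representation `σ : G → U(n)`; `U(n)` is the group of linear isometries of `ℂⁿ`. -/
abbrev UnitaryAction (G : Type) [Group G] (n : ℕ) : Type :=
  G →* (CSpace n ≃ₗᵢ[ℂ] CSpace n)

namespace UnitaryAction

variable {G : Type} [Group G] {n : ℕ}

/-- `x ∼ y` when `x = g y` for some `g`. -/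
def orbitSetoid (σ : UnitaryAction G n) : Setoid (CSpace n) where
  r x y := ∃ g : G, x = σ g y
  iseqv :=
    { refl := fun x => ⟨1, by simp⟩
      symm := by
        rintro x y ⟨g, rfl⟩
        refine ⟨g⁻¹, ?_⟩
        rw [map_inv]
        exact ((σ g).symm_apply_apply y).symm
      trans := by
        rintro x y z ⟨g, rfl⟩ ⟨h, rfl⟩
        exact ⟨g * h, by simp⟩ }

/-- The orbit space `ℂⁿ / G`. -/
abbrev OrbitSpace (σ : UnitaryAction G n) : Type := Quotient σ.orbitSetoid

/-- The number `inf_g ‖x - g y‖`. -/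
noncomputable def orbitDist (σ : UnitaryAction G n) (x y : CSpace n) : ℝ :=
  ⨅ g : G, ‖x - σ g y‖

theorem orbitDist_congr (σ : UnitaryAction G n) (h k : G) (x y : CSpace n) :
    σ.orbitDist (σ h x) (σ k y) = σ.orbitDist x y := by
  unfold orbitDist
  refine Equiv.iInf_congr ((Equiv.mulLeft h⁻¹).trans (Equiv.mulRight k)) fun g => ?_
  rw [← (σ h).norm_map (x - _)]
  simp

/-- The quotient metric `d_G([x], [y]) = inf_g ‖x - g y‖` on `ℂⁿ / G`. -/
noncomputable def quotDist (σ : UnitaryAction G n) : σ.OrbitSpace → σ.OrbitSpace → ℝ :=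
  Quotient.lift₂ σ.orbitDist (by
    rintro x y x' y' ⟨g, rfl⟩ ⟨h, rfl⟩
    exact σ.orbitDist_congr g h x' y')

/-- `Φ` is `G`-invariant. -/
def IsInvariant (σ : UnitaryAction G n) {W : Type} (Φ : CSpace n → W) : Prop :=
  ∀ (g : G) (x : CSpace n), Φ (σ g x) = Φ x

/-- The map induced on `ℂⁿ / G` by a `G`-invariant map. -/
def induced (σ : UnitaryAction G n) {W : Type} (Φ : CSpace n → W) (hΦ : σ.IsInvariant Φ) :
    σ.OrbitSpace → W :=
  Quotient.lift Φ (by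
    rintro x y ⟨g, rfl⟩
    exact hΦ g y)

/-- `Φ` is invariant and separates orbits: the induced map on `ℂⁿ / G` is injective. -/
def InducesInjective (σ : UnitaryAction G n) {W : Type} (Φ : CSpace n → W) : Prop :=
  ∃ hΦ : σ.IsInvariant Φ, Function.Injective (σ.induced Φ hΦ)

/-- `Φ` is invariant and the induced map on `ℂⁿ / G` is Lipschitz with constant `C`
with respect to the quotient metric `d_G`. -/
def InducesLipschitz (σ : UnitaryAction G n) {k : ℕ} (Φ : CSpace n → CSpace k) (C : ℝ) : Prop :=
  ∃ hΦ : σ.IsInvariant Φ, ∀ p q : σ.OrbitSpace,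
    ‖σ.induced Φ hΦ p - σ.induced Φ hΦ q‖ ≤ C * σ.quotDist p q

/-- In the orthonormal basis `b` the generator `1` of `ℤ/m` acts by the diagonal matrix
`T = diag(t₁, …, tₙ)`. -/
def IsDiagonalIn {m : ℕ} (σ : UnitaryAction (Multiplicative (ZMod m)) n)
    (b : OrthonormalBasis (Fin n) ℂ (CSpace n)) (t : Fin n → ℂ) : Prop :=
  ∀ i, σ (Multiplicative.ofAdd 1) (b i) = t i • b i

end UnitaryAction

namespace SepMonomials

/-- Index set of the separating monomials: the `n` pure powers and the pairs `j < k`. -/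
abbrev Idx (n : ℕ) : Type := Fin n ⊕ {p : Fin n × Fin n // p.1 < p.2}

/-- The space `ℂ^{n(n+1)/2}` with its Euclidean norm. -/
abbrev Space (n : ℕ) : Type := EuclideanSpace ℂ (Idx n)

/-- The monomial `x_j^a x_k^b` (`j ≠ k`) is invariant under `T = diag(t)`. -/
def Invariant {n : ℕ} (t : Fin n → ℂ) (j k : Fin n) (a b : ℕ) : Prop :=
  ∀ z w : ℂ, (t j * z) ^ a * (t k * w) ^ b = z ^ a * w ^ b

/-- `a_{jk}`: the least positive `a` such that `x_j^a x_k^b` is invariant for some `b < m_k`,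
where `m_k` is the order of `t_k`. -/
noncomputable def expA {n : ℕ} (t : Fin n → ℂ) (j k : Fin n) : ℕ :=
  sInf {a : ℕ | 0 < a ∧ ∃ b : ℕ, b < orderOf (t k) ∧ Invariant t j k a b}

/-- `b_{jk}`: the (unique) `b < m_k` such that `x_j^{a_{jk}} x_k^b` is invariant. -/
noncomputable def expB {n : ℕ} (t : Fin n → ℂ) (j k : Fin n) : ℕ :=
  sInf {b : ℕ | b < orderOf (t k) ∧ Invariant t j k (expA t j k) b}

/-- `F_T(x) = ((x_i^{m_i})_i, (x_j^{a_{jk}} x_k^{b_{jk}})_{j<k})` for `T = diag(t)`. -/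
noncomputable def F {n : ℕ} (t : Fin n → ℂ) (x : CSpace n) : Space n :=
  WithLp.toLp 2 (Sum.elim
    (fun i => x i ^ orderOf (t i))
    (fun p => x p.1.1 ^ expA t p.1.1 p.1.2 * x p.1.2 ^ expB t p.1.1 p.1.2))

theorem card_idx (n : ℕ) : Fintype.card (Idx n) = n * (n + 1) / 2 := by
  have h2 : Fintype.card {p : Fin n × Fin n // p.1 < p.2} = n.choose 2 := by
    rw [Fintype.card_subtype, ← Finset.univ_product_univ, Finset.card_filter,
      Finset.sum_product_right]
    simp only [← Finset.card_filter]
    have : ∀ y : Fin n, (Finset.univ.filter fun x : Fin n => x < y).card = (y : ℕ) := by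
      intro y
      rw [← Fin.card_Iio y]
      congr 1
      ext; simp
    simp only [this]
    rw [Fin.sum_univ_eq_sum_range (fun i => i) n, Finset.sum_range_id, Nat.choose_two_right]
  rw [Fintype.card_sum, Fintype.card_fin, h2, ← Nat.choose_one_right n, add_comm,
    Nat.choose_one_right, mul_comm]
  have : (n + 1).choose 2 = n.choose 1 + n.choose 2 := Nat.choose_succ_succ' n 1
  rw [Nat.choose_one_right, Nat.choose_two_right] at this
  simp only [Nat.add_sub_cancel] at this
  omega

end SepMonomials

/-- `Φ_F(x) = ‖x‖ F(x / ‖x‖)` for `x ≠ 0` and `Φ_F(0) = 0`. -/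
noncomputable def normalized {n k : ℕ} (F : CSpace n → CSpace k) (x : CSpace n) : CSpace k :=
  open Classical in
  if x = 0 then 0 else (‖x‖ : ℂ) • F ((‖x‖ : ℂ)⁻¹ • x)

/-- Linear maps `ℂ^{n(n+1)/2} → ℂ^k`; `‖ℓ‖` is the operator norm for the Euclidean norms. -/
abbrev Reduction (n k : ℕ) : Type := SepMonomials.Space n →L[ℂ] CSpace k

namespace Reduction

/-- The operator norm of `ℓ` when `ℂ^{n(n+1)/2}` carries the maximum norm and `ℂ^k` the
Euclidean norm. -/
noncomputable def supOpNorm {n k : ℕ} (ℓ : Reduction n k) : ℝ :=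
  ‖ℓ.comp (PiLp.continuousLinearEquiv 2 ℂ
    (fun _ : SepMonomials.Idx n => ℂ)).symm.toContinuousLinearMap‖

/-- The real coordinates of `ℓ`: the real (`false`) and imaginary (`true`) parts of its
matrix entries. -/
noncomputable def coords {n k : ℕ} (ℓ : Reduction n k) :
    (Fin k × SepMonomials.Idx n) × Bool → ℝ :=
  fun c =>
    let z : ℂ := ℓ (EuclideanSpace.single c.1.2 1) c.1.1
    bif c.2 then z.im else z.re

/-- `P` holds for generic `ℓ`: outside the zero set of some nonzero real polynomial in the real
and imaginary parts of the matrix entries of `ℓ`. -/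
def Generic {n k : ℕ} (P : Reduction n k → Prop) : Prop :=
  ∃ Q : MvPolynomial ((Fin k × SepMonomials.Idx n) × Bool) ℝ,
    Q ≠ 0 ∧ ∀ ℓ : Reduction n k, MvPolynomial.eval ℓ.coords Q ≠ 0 → P ℓ

end Reduction

/-- The invariant map: `ℓ ∘ F_T` evaluated in the coordinates of the basis `b`. -/
noncomputable def reducedMap {n k : ℕ} (b : OrthonormalBasis (Fin n) ℂ (CSpace n))
    (t : Fin n → ℂ) (ℓ : Reduction n k) (x : CSpace n) : CSpace k :=
  ℓ (SepMonomials.F t (b.repr x))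

/-- The map `Φ_{ℓ ∘ F_T}` evaluated in the coordinates of the basis `b`. -/
noncomputable def repMap {n k : ℕ} (b : OrthonormalBasis (Fin n) ℂ (CSpace n))
    (t : Fin n → ℂ) (ℓ : Reduction n k) (x : CSpace n) : CSpace k :=
  normalized (fun y => ℓ (SepMonomials.F t y)) (b.repr x)

/-! The generator is an isometry killed by the separable polynomial `X ^ m - 1`, hence
diagonalizable in an orthonormal basis. If `F t x = F t y`, the pure powers give `y i = t i ^ r i *
x i`, and the pair monomials force `r j ≡ r k` modulo `gcd (m_j, m_k)` on the support of `x`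
(`orderOf_pow_expB`). These congruences have a common solution, so `x` and `y` share an orbit.

A generic `ℓ` keeps this separation by a dimension count: the vectors `ρ F(x) - F(y)` with `ρ` real
form a family with `4n + 1 < 2(2n + 1)` real parameters, so the `ℓ` annihilating a nonzero one have
algebraically dependent coordinates (`exists_polynomial_separating`). The factor `ρ = ‖x‖ / ‖y‖`
covers the homogenized map as well.

Each coordinate of `homF` is `2m`-Lipschitz (`norm_homF_sub_apply_le`), which gives (a) with room to
spare. For (b) a bound free of `n` needs an `ℓ` close to a projection onto one coordinate; a small
generic perturbation of half such a projection is absorbed in the slack between `2m` and `3m`. -/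

/-! ### Diagonalization of the generator. -/

theorem UnitaryAction.exists_isDiagonalIn {m n : ℕ} (hm : 1 ≤ m)
    (σ : UnitaryAction (Multiplicative (ZMod m)) n) :
    ∃ (b : OrthonormalBasis (Fin n) ℂ (CSpace n)) (t : Fin n → ℂ), σ.IsDiagonalIn b t := by
  classical
  set U : CSpace n ≃ₗᵢ[ℂ] CSpace n := σ (Multiplicative.ofAdd 1) with hU
  have hUm : U ^ m = 1 := by
    rw [hU, ← map_pow, ← ofAdd_nsmul]
    simp
  set T : Module.End ℂ (CSpace n) := U.toLinearEquiv.toLinearMap with hT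
  have hTpow : ∀ (k : ℕ) (x : CSpace n), (T ^ k) x = (U ^ k) x := by
    intro k
    induction k with
    | zero => intro x; rfl
    | succ k ih => intro x; rw [pow_succ, pow_succ]; exact ih (U x)
  have hTm : T ^ m = 1 := by
    ext1 x
    rw [hTpow, hUm]
    rfl
  have hm0 : (m : ℂ) ≠ 0 := by exact_mod_cast (show m ≠ 0 by omega)
  have hss : T.IsSemisimple := by
    refine Module.End.isSemisimple_of_squarefree_aeval_eq_zero
      (p := Polynomial.X ^ m - 1)
      (Polynomial.separable_X_pow_sub_C (1 : ℂ) hm0 one_ne_zero |>.squarefree) ?_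
    simp [hTm]
  have horth : OrthogonalFamily ℂ (fun μ : ℂ => Module.End.eigenspace T μ)
      fun μ => (Module.End.eigenspace T μ).subtypeₗᵢ := by
    refine OrthogonalFamily.of_pairwise fun μ ν hμν v hv w hw => ?_
    rw [Module.End.mem_eigenspace_iff] at hv hw
    by_contra hne
    replace hne : inner ℂ v w ≠ 0 := fun h0 => hne (inner_eq_zero_symm.mp h0)
    have hv0 : v ≠ 0 := by rintro rfl; simp at hne
    have hvn : ‖μ‖ = 1 := by
      have h1 : ‖T v‖ = ‖v‖ := U.norm_map v
      rw [hv, norm_smul] at h1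
      exact mul_right_cancel₀ (norm_ne_zero_iff.mpr hv0) (by rw [h1, one_mul])
    have h2 : inner ℂ (T v) (T w) = inner ℂ v w := U.inner_map_map v w
    rw [hv, hw, inner_smul_left, inner_smul_right, ← mul_assoc] at h2
    -- If the inner product were nonzero, `ν` and `μ` would both be inverse to the conjugate of `μ`.
    have h3 : (starRingEnd ℂ) μ * ν = 1 :=
      mul_right_cancel₀ hne (by rw [h2, one_mul])
    have h4 : (starRingEnd ℂ) μ * μ = 1 := by
      rw [mul_comm, Complex.mul_conj, Complex.normSq_eq_norm_sq, hvn]; simp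
    have h5 : (starRingEnd ℂ) μ ≠ 0 := left_ne_zero_of_mul_eq_one h4
    exact hμν (mul_left_cancel₀ h5 (h4.trans h3.symm))
  have horth' : OrthogonalFamily ℂ (fun μ : Module.End.Eigenvalues T => Module.End.eigenspace T μ)
      fun μ => (Module.End.eigenspace T μ).subtypeₗᵢ :=
    horth.comp Subtype.coe_injective
  have hint : DirectSum.IsInternal
      (fun μ : Module.End.Eigenvalues T => Module.End.eigenspace T μ) := by
    rw [horth'.isInternal_iff]
    rw [Submodule.orthogonal_eq_bot_iff]
    exact (iSup_ne_bot_subtype _).trans hss.iSup_eigenspace_eq_top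
  have hfr : Module.finrank ℂ (CSpace n) = n := by simp
  refine ⟨hint.subordinateOrthonormalBasis hfr horth',
    fun i => (hint.subordinateOrthonormalBasisIndex hfr i horth' : Module.End.Eigenvalues T),
    fun i => ?_⟩
  exact Module.End.mem_eigenspace_iff.mp
    (hint.subordinateOrthonormalBasis_subordinate hfr i horth')

theorem UnitaryAction.IsDiagonalIn.pow_eq_one {m n : ℕ}
    {σ : UnitaryAction (Multiplicative (ZMod m)) n}
    {b : OrthonormalBasis (Fin n) ℂ (CSpace n)} {t : Fin n → ℂ} (h : σ.IsDiagonalIn b t)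
    (i : Fin n) : t i ^ m = 1 := by
  have hk : ∀ k : ℕ, σ (Multiplicative.ofAdd 1 ^ k) (b i) = t i ^ k • b i := by
    intro k
    induction k with
    | zero => simp
    | succ k ih =>
      rw [pow_succ', map_mul, LinearIsometryEquiv.coe_mul, Function.comp_apply, ih, map_smul,
        h i, smul_smul, pow_succ]
  have h1 := hk m
  rw [← ofAdd_nsmul] at h1
  simp only [nsmul_eq_mul, CharP.cast_eq_zero, zero_mul, ofAdd_zero, map_one,
    LinearIsometryEquiv.coe_one, id] at h1
  have h2 : ((1 : ℂ) - t i ^ m) • b i = 0 := by rw [sub_smul, ← h1, one_smul, sub_self]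
  have h3 := (smul_eq_zero.mp h2).resolve_right (b.orthonormal.ne_zero i)
  exact (sub_eq_zero.mp h3).symm

/-- The coordinates of the translate by `k` steps of the generator. -/
theorem UnitaryAction.IsDiagonalIn.repr_apply {m n : ℕ}
    {σ : UnitaryAction (Multiplicative (ZMod m)) n}
    {b : OrthonormalBasis (Fin n) ℂ (CSpace n)} {t : Fin n → ℂ} (h : σ.IsDiagonalIn b t)
    (k : ℕ) (x : CSpace n) (i : Fin n) :
    b.repr (σ (Multiplicative.ofAdd 1 ^ k) x) i = t i ^ k * b.repr x i := by
  have h1 : ∀ x, b.repr (σ (Multiplicative.ofAdd 1) x) i = t i * b.repr x i := by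
    intro x
    conv_lhs => rw [← b.sum_repr x]
    simp [map_sum, h _, Finset.sum_apply, Pi.single_apply, mul_comm]
  induction k with
  | zero => simp
  | succ k ih =>
    rw [pow_succ', map_mul, LinearIsometryEquiv.coe_mul, Function.comp_apply, h1, ih]
    ring

/-! ### Systems of congruences with non-coprime moduli. -/

theorem ZMod.exists_pow_ofAdd_one {m : ℕ} (hm : 1 ≤ m) (g : Multiplicative (ZMod m)) :
    ∃ k : ℕ, g = Multiplicative.ofAdd 1 ^ k := by
  have : NeZero m := ⟨by omega⟩
  refine ⟨(Multiplicative.toAdd g).val, ?_⟩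
  rw [← ofAdd_nsmul]
  simp

/-- Multiplying by the gcd of `gcd a k` and `gcd b k` turns the right side into `gcd a k * gcd b k`,
the gcd of `ab`, `kb`, `ak`, `kk`; the left side, so multiplied, divides each of these. -/
theorem Nat.gcd_lcm_dvd (a b k : ℕ) :
    Nat.gcd (Nat.lcm a b) k ∣ Nat.lcm (Nat.gcd a k) (Nat.gcd b k) := by
  rcases Nat.eq_zero_or_pos (Nat.gcd (Nat.gcd a k) (Nat.gcd b k)) with h0 | h0
  · obtain ⟨h1, h2⟩ := Nat.gcd_eq_zero_iff.mp h0
    rw [h1, Nat.lcm_zero_left]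
    exact dvd_zero _
  · refine Nat.dvd_of_mul_dvd_mul_left h0 ?_
    rw [Nat.gcd_mul_lcm, ← Nat.gcd_mul_left (Nat.gcd a k) b k, ← Nat.gcd_mul_right a b k,
      ← Nat.gcd_mul_right a k k]
    have ha := (Nat.gcd_dvd_left (Nat.gcd a k) (Nat.gcd b k)).trans (Nat.gcd_dvd_left a k)
    have hk := (Nat.gcd_dvd_left (Nat.gcd a k) (Nat.gcd b k)).trans (Nat.gcd_dvd_right a k)
    have hb := (Nat.gcd_dvd_right (Nat.gcd a k) (Nat.gcd b k)).trans (Nat.gcd_dvd_left b k)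
    have hL := Nat.gcd_dvd_left (Nat.lcm a b) k
    have hK := Nat.gcd_dvd_right (Nat.lcm a b) k
    refine Nat.dvd_gcd (Nat.dvd_gcd ?_ ?_) (Nat.dvd_gcd ?_ ?_)
    · rw [← Nat.gcd_mul_lcm a b]
      exact mul_dvd_mul (Nat.dvd_gcd ha hb) hL
    · rw [mul_comm k b]
      exact mul_dvd_mul hb hK
    · exact mul_dvd_mul ha hK
    · exact mul_dvd_mul hk hK

theorem Nat.gcd_finset_lcm_dvd {ι : Type*} (s : Finset ι) (m : ι → ℕ) (k : ℕ) :
    Nat.gcd (s.lcm m) k ∣ s.lcm fun i => Nat.gcd (m i) k := by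
  classical
  induction s using Finset.induction_on with
  | empty => simp
  | insert a s ha ih =>
    rw [Finset.lcm_insert, Finset.lcm_insert]
    have h1 := Nat.gcd_lcm_dvd (m a) (s.lcm m) k
    exact h1.trans (Nat.lcm_dvd (Nat.dvd_lcm_left _ _) (ih.trans (Nat.dvd_lcm_right _ _)))

/-- A pairwise compatible finite system of congruences is solvable. -/
theorem Nat.exists_modEq_of_pairwise {ι : Type*} (s : Finset ι) (m r : ι → ℕ)
    (h : ∀ i ∈ s, ∀ j ∈ s, r i ≡ r j [MOD Nat.gcd (m i) (m j)]) :
    ∃ c : ℕ, ∀ i ∈ s, c ≡ r i [MOD m i] := by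
  classical
  induction s using Finset.induction_on with
  | empty => exact ⟨0, by simp⟩
  | insert a s ha ih =>
    obtain ⟨c, hc⟩ := ih fun i hi j hj =>
      h i (Finset.mem_insert_of_mem hi) j (Finset.mem_insert_of_mem hj)
    -- The congruences solved so far amount to one modulo the lcm; compatibility with the new one
    -- can be tested modulo each `gcd (m i) (m a)`.
    have key : c ≡ r a [MOD Nat.gcd (s.lcm m) (m a)] := by
      rw [Nat.modEq_iff_dvd]
      have hlcm : (s.lcm fun i => Nat.gcd (m i) (m a)) ∣ ((r a : ℤ) - c).natAbs := by
        refine Finset.lcm_dvd fun i hi => ?_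
        have h1 : c ≡ r i [MOD Nat.gcd (m i) (m a)] := (hc i hi).of_dvd (Nat.gcd_dvd_left _ _)
        have h2 := h1.trans (h i (Finset.mem_insert_of_mem hi) a (Finset.mem_insert_self _ _))
        exact Int.natCast_dvd.mp (Nat.modEq_iff_dvd.mp h2)
      exact Int.natCast_dvd.mpr ((Nat.gcd_finset_lcm_dvd s m (m a)).trans hlcm)
    obtain ⟨d, hd1, hd2⟩ := Nat.chineseRemainder' key
    refine ⟨d, fun i hi => ?_⟩
    rcases Finset.mem_insert.mp hi with rfl | hi
    · exact hd2
    · exact (hd1.of_dvd (Finset.dvd_lcm hi)).trans (hc i hi)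

/-! ### The monomials separate orbits. -/

namespace SepMonomials

variable {n : ℕ} {t : Fin n → ℂ}

theorem invariant_iff {j k : Fin n} {a b : ℕ} :
    Invariant t j k a b ↔ t j ^ a * t k ^ b = 1 := by
  constructor
  · intro h
    simpa using h 1 1
  · intro h z w
    rw [mul_pow, mul_pow, mul_mul_mul_comm, h, one_mul]

theorem exists_inv_mul_pow {z w : ℂ} (hw : 0 < orderOf w) (hz : z ^ orderOf w = 1) :
    ∃ b < orderOf w, z * w ^ b = 1 := by
  have hp := IsPrimitiveRoot.orderOf w
  have : NeZero (orderOf w) := ⟨hw.ne'⟩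
  obtain ⟨b, hb, hbz⟩ := hp.eq_pow_of_pow_eq_one (ξ := z⁻¹) (by rw [inv_pow, hz, inv_one])
  have hz0 : z ≠ 0 := by rintro rfl; simp [hw.ne'] at hz
  exact ⟨b, hb, by rw [hbz, mul_inv_cancel₀ hz0]⟩

section

variable (ht : ∀ i, 0 < orderOf (t i))
include ht

theorem expA_spec (j k : Fin n) : 0 < expA t j k ∧
    ∃ b : ℕ, b < orderOf (t k) ∧ Invariant t j k (expA t j k) b :=
  Nat.sInf_mem (s := {a : ℕ | 0 < a ∧ ∃ b : ℕ, b < orderOf (t k) ∧ Invariant t j k a b})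
    ⟨orderOf (t j), ht j, 0, ht k, by simp [invariant_iff, pow_orderOf_eq_one]⟩

/-- When `t j ^ a` is an `m_k`-th root of unity, its inverse is a power of the primitive root `t k`,
so `x_j ^ a` can be completed to an invariant monomial. -/
theorem expA_le {j k : Fin n} {a : ℕ} (ha : 0 < a) (h : t j ^ (a * orderOf (t k)) = 1) :
    expA t j k ≤ a := by
  rw [pow_mul] at h
  obtain ⟨b, hb, hab⟩ := exists_inv_mul_pow (ht k) h
  exact Nat.sInf_le ⟨ha, b, hb, invariant_iff.mpr hab⟩

theorem expA_le_orderOf (j k : Fin n) : expA t j k ≤ orderOf (t j) :=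
  expA_le ht (ht j) (by rw [pow_mul, pow_orderOf_eq_one, one_pow])

theorem expB_spec (j k : Fin n) :
    expB t j k < orderOf (t k) ∧ t j ^ expA t j k * t k ^ expB t j k = 1 := by
  obtain ⟨b, hb⟩ := (expA_spec ht j k).2
  have := Nat.sInf_mem (s := {b : ℕ | b < orderOf (t k) ∧ Invariant t j k (expA t j k) b}) ⟨b, hb⟩
  exact ⟨this.1, invariant_iff.mp this.2⟩

/-- This is where minimality of `a = expA t j k` enters. Let `g` be the gcd and `o` the order of `t
k ^ b`, which is also that of its inverse `t j ^ a`. Then `a ≤ m_j / g` by `expA_le`, while `t j ^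
(a * o) = 1` gives `m_j ≤ a * o`; hence `g ≤ o`, and `o ∣ g`. -/
theorem orderOf_pow_expB (j k : Fin n) :
    Nat.gcd (orderOf (t j)) (orderOf (t k)) ∣ orderOf (t k ^ expB t j k) := by
  have hAB := (expB_spec ht j k).2
  have hA := (expA_spec ht j k).1
  set a := expA t j k
  set g := Nat.gcd (orderOf (t j)) (orderOf (t k)) with hg
  have hg0 : 0 < g := Nat.gcd_pos_of_pos_left _ (ht j)
  set o := orderOf (t k ^ expB t j k) with ho
  have hinv : ∀ e : ℕ, (t j ^ a) ^ e = 1 ↔ (t k ^ expB t j k) ^ e = 1 := by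
    intro e
    have h1 : (t j ^ a) ^ e * (t k ^ expB t j k) ^ e = 1 := by rw [← mul_pow, hAB, one_pow]
    constructor <;> intro h <;> simpa [h] using h1
  have hoj : o = orderOf (t j ^ a) :=
    (orderOf_eq_orderOf_iff.mpr hinv).symm
  have hog : o ∣ g := Nat.dvd_gcd (hoj ▸ orderOf_pow_dvd a) (orderOf_pow_dvd _)
  have hag : a ≤ orderOf (t j) / g := by
    have hd : g ∣ orderOf (t j) := Nat.gcd_dvd_left _ _
    refine expA_le ht (Nat.div_pos (Nat.le_of_dvd (ht j) hd) hg0) ?_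
    obtain ⟨c, hc⟩ : g ∣ orderOf (t k) := Nat.gcd_dvd_right _ _
    rw [hc, ← mul_assoc, Nat.div_mul_cancel hd, pow_mul, pow_orderOf_eq_one, one_pow]
  have hle : orderOf (t j) ≤ a * o := by
    refine Nat.le_of_dvd ?_ (orderOf_dvd_of_pow_eq_one ?_)
    · refine Nat.mul_pos hA ?_
      exact Nat.pos_of_dvd_of_pos hog hg0
    · rw [pow_mul, hoj, pow_orderOf_eq_one]
  have h2 : a * g ≤ orderOf (t j) := by
    rw [← Nat.le_div_iff_mul_le hg0]; exact hag
  have h3 : g ≤ o := Nat.le_of_mul_le_mul_left (h2.trans hle) hA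
  have : o = g := le_antisymm (Nat.le_of_dvd hg0 hog) h3
  rw [this]

theorem F_pow_smul {x y : CSpace n} {c : ℕ} (h : ∀ i, y i = t i ^ c * x i) : F t y = F t x := by
  unfold F
  congr 1
  funext e
  rcases e with i | ⟨⟨j, k⟩, hjk⟩
  · simp only [Sum.elim_inl, h, mul_pow]
    rw [← pow_mul, mul_comm c, pow_mul, pow_orderOf_eq_one, one_pow, one_mul]
  · simp only [Sum.elim_inr, h, mul_pow]
    rw [mul_mul_mul_comm, ← pow_mul, ← pow_mul, mul_comm c, mul_comm c, pow_mul, pow_mul,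
      ← mul_pow, (expB_spec ht j k).2, one_pow, one_mul]

/-- The map `F` separates the orbits of the diagonal action. -/
theorem exists_pow_of_F_eq {x y : CSpace n} (h : F t y = F t x) :
    ∃ c : ℕ, ∀ i, y i = t i ^ c * x i := by
  classical
  have hpure : ∀ i, y i ^ orderOf (t i) = x i ^ orderOf (t i) := fun i =>
    congrArg (fun v : Space n => v (Sum.inl i)) h
  have hpair : ∀ j k, j < k → y j ^ expA t j k * y k ^ expB t j k =
      x j ^ expA t j k * x k ^ expB t j k := fun j k hjk =>
    congrArg (fun v : Space n => v (Sum.inr ⟨(j, k), hjk⟩)) h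
  have hr : ∀ i, ∃ r : ℕ, y i = t i ^ r * x i := by
    intro i
    by_cases hx : x i = 0
    · refine ⟨0, ?_⟩
      have := hpure i
      rw [hx, zero_pow (ht i).ne'] at this
      rw [hx, mul_zero, eq_zero_of_pow_eq_zero this]
    · have : NeZero (orderOf (t i)) := ⟨(ht i).ne'⟩
      obtain ⟨r, -, hr⟩ := (IsPrimitiveRoot.orderOf (t i)).eq_pow_of_pow_eq_one
        (ξ := y i / x i) (by rw [div_pow, hpure, div_self (pow_ne_zero _ hx)])
      exact ⟨r, by rw [hr, div_mul_cancel₀ _ hx]⟩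
  choose r hr using hr
  have ht0 : ∀ i, t i ≠ 0 := fun i h0 => by
    have := ht i
    rw [h0, orderOf_zero] at this
    exact lt_irrefl _ this
  have hlt : ∀ j k, j < k → x j ≠ 0 → x k ≠ 0 →
      r j ≡ r k [MOD Nat.gcd (orderOf (t j)) (orderOf (t k))] := by
    intro j k hjk hj hk
    have h1 := hpair j k hjk
    rw [hr j, hr k, mul_pow, mul_pow, mul_mul_mul_comm] at h1
    have h2 : (t j ^ r j) ^ expA t j k * (t k ^ r k) ^ expB t j k = 1 :=
      mul_right_cancel₀ (mul_ne_zero (pow_ne_zero _ hj) (pow_ne_zero _ hk))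
        (by rw [h1, one_mul])
    -- Using the exponent `r j` in both factors gives an invariance relation; comparison with `h2`
    -- leaves only powers of `t k ^ b`.
    have h3 : (t j ^ r j) ^ expA t j k * (t k ^ r j) ^ expB t j k = 1 := by
      rw [← pow_mul, ← pow_mul, mul_comm, mul_comm (r j), mul_comm (r j), pow_mul, pow_mul,
        ← mul_pow, mul_comm, (expB_spec ht j k).2, one_pow]
    have h4 : (t k ^ expB t j k) ^ r j = (t k ^ expB t j k) ^ r k := by
      rw [← pow_mul, ← pow_mul, mul_comm _ (r j), mul_comm _ (r k), pow_mul, pow_mul]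
      exact mul_left_cancel₀ (left_ne_zero_of_mul_eq_one h2) (h3.trans h2.symm)
    have h5 := (pow_eq_pow_iff_modEq (x := Units.mk0 _ (pow_ne_zero (expB t j k) (ht0 k)))).mp
      (Units.ext h4)
    rw [← orderOf_units] at h5
    exact h5.of_dvd (orderOf_pow_expB ht j k)
  -- Where `x i = 0` any exponent works, so only the support imposes congruences.
  obtain ⟨c, hc⟩ := Nat.exists_modEq_of_pairwise (Finset.univ.filter fun i => x i ≠ 0)
    (fun i => orderOf (t i)) r (by
      intro j hj k hk
      simp only [Finset.mem_filter, Finset.mem_univ, true_and] at hj hk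
      rcases lt_trichotomy j k with hjk | rfl | hjk
      · exact hlt j k hjk hj hk
      · exact Nat.ModEq.refl _
      · rw [Nat.gcd_comm]
        exact (hlt k j hjk hk hj).symm)
  refine ⟨c, fun i => ?_⟩
  by_cases hx : x i = 0
  · rw [hr i, hx, mul_zero, mul_zero]
  · rw [hr i]
    congr 1
    have := hc i (by simp [hx])
    rw [pow_eq_pow_mod c (pow_orderOf_eq_one _), this, ← pow_eq_pow_mod _ (pow_orderOf_eq_one _)]

end

end SepMonomials

/-! ### Polynomial parametrizations and algebraic dependence. -/

/-- The real polynomial functions on `ℝ^κ`. -/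
noncomputable def realPolynomialFunctions (κ : Type) : Subalgebra ℝ ((κ → ℝ) → ℝ) :=
  (MvPolynomial.aeval (R := ℝ) fun (i : κ) (x : κ → ℝ) => x i).range

theorem mem_realPolynomialFunctions {κ : Type} {f : (κ → ℝ) → ℝ} :
    f ∈ realPolynomialFunctions κ ↔ ∃ P : MvPolynomial κ ℝ, ∀ x, MvPolynomial.eval x P = f x := by
  have h : ∀ (P : MvPolynomial κ ℝ) (x : κ → ℝ),
      MvPolynomial.aeval (R := ℝ) (fun (i : κ) (x : κ → ℝ) => x i) P x
        = MvPolynomial.eval x P := by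
    intro P x
    have := MvPolynomial.map_aeval (fun (i : κ) (x : κ → ℝ) => x i)
      (Pi.evalRingHom (fun _ : κ → ℝ => ℝ) x) P
    exact this
  constructor
  · rintro ⟨P, rfl⟩
    exact ⟨P, fun x => (h P x).symm⟩
  · rintro ⟨P, hP⟩
    exact ⟨P, funext fun x => (h P x).trans (hP x)⟩

/-- More polynomial functions than variables satisfy a nontrivial polynomial relation. -/
theorem exists_polynomial_relation {κ β : Type} [Fintype κ] [Fintype β]
    (hcard : Fintype.card κ < Fintype.card β) (f : β → (κ → ℝ) → ℝ)
    (hf : ∀ b, f b ∈ realPolynomialFunctions κ) :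
    ∃ Q : MvPolynomial β ℝ, Q ≠ 0 ∧ ∀ x, MvPolynomial.eval (fun b => f b x) Q = 0 := by
  choose P hP using fun b => mem_realPolynomialFunctions.mp (hf b)
  have hdep : ¬ AlgebraicIndependent ℝ P := by
    intro h
    have := h.cardinalMk_le_trdeg
    rw [MvPolynomial.trdeg_of_isDomain, Cardinal.mk_fintype, Cardinal.mk_fintype,
      Cardinal.lift_natCast, Nat.cast_le] at this
    omega
  rw [algebraicIndependent_iff] at hdep
  push Not at hdep
  obtain ⟨Q, hQ, hQ0⟩ := hdep
  refine ⟨Q, hQ0, fun x => ?_⟩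
  have h1 := MvPolynomial.map_aeval P (MvPolynomial.eval x) Q
  rw [hQ, map_zero] at h1
  rw [h1]
  simp only [hP]
  have : (MvPolynomial.eval x).comp (algebraMap ℝ (MvPolynomial κ ℝ)) = RingHom.id ℝ := by
    ext r
    simp
  rw [this]
  rfl

/-- Complex-valued functions on `ℝ^κ` with polynomial real and imaginary parts. -/
def IsComplexPolynomial {κ : Type} (g : (κ → ℝ) → ℂ) : Prop :=
  (fun x => (g x).re) ∈ realPolynomialFunctions κ ∧ (fun x => (g x).im) ∈ realPolynomialFunctions κ

namespace IsComplexPolynomial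

variable {κ κ' : Type} {f g : (κ → ℝ) → ℂ}

theorem add (hf : IsComplexPolynomial f) (hg : IsComplexPolynomial g) :
    IsComplexPolynomial fun x => f x + g x :=
  ⟨add_mem hf.1 hg.1, add_mem hf.2 hg.2⟩

theorem neg (hf : IsComplexPolynomial f) : IsComplexPolynomial fun x => -f x :=
  ⟨neg_mem hf.1, neg_mem hf.2⟩

theorem mul (hf : IsComplexPolynomial f) (hg : IsComplexPolynomial g) :
    IsComplexPolynomial fun x => f x * g x := by
  constructor
  · exact sub_mem (mul_mem hf.1 hg.1) (mul_mem hf.2 hg.2)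
  · exact add_mem (mul_mem hf.1 hg.2) (mul_mem hf.2 hg.1)

theorem one : IsComplexPolynomial fun _ : κ → ℝ => (1 : ℂ) := by
  constructor
  · exact one_mem _
  · exact zero_mem _

theorem zero : IsComplexPolynomial fun _ : κ → ℝ => (0 : ℂ) := by
  constructor
  · exact zero_mem _
  · exact zero_mem _

theorem pow (hf : IsComplexPolynomial f) (k : ℕ) : IsComplexPolynomial fun x => f x ^ k := by
  induction k with
  | zero => simpa using one
  | succ k ih => simpa only [pow_succ] using ih.mul hf

theorem sum {ι : Type} (s : Finset ι) {h : ι → (κ → ℝ) → ℂ}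
    (hh : ∀ i ∈ s, IsComplexPolynomial (h i)) :
    IsComplexPolynomial fun x => ∑ i ∈ s, h i x := by
  classical
  induction s using Finset.induction_on with
  | empty => simpa using zero
  | insert a s ha ih =>
    simp only [Finset.sum_insert ha]
    exact (hh a (Finset.mem_insert_self _ _)).add
      (ih fun i hi => hh i (Finset.mem_insert_of_mem hi))

theorem coord (i : κ) : (fun x : κ → ℝ => x i) ∈ realPolynomialFunctions κ :=
  mem_realPolynomialFunctions.mpr ⟨MvPolynomial.X i, fun x => by simp⟩

theorem ofReal_coord (i : κ) : IsComplexPolynomial fun x : κ → ℝ => (x i : ℂ) := by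
  constructor
  · exact coord i
  · exact zero_mem _

theorem mk_coord (i j : κ) : IsComplexPolynomial fun x : κ → ℝ => (⟨x i, x j⟩ : ℂ) :=
  ⟨coord i, coord j⟩

theorem comp_index (hf : IsComplexPolynomial f) (φ : κ → κ') :
    IsComplexPolynomial fun x : κ' → ℝ => f fun i => x (φ i) := by
  have h : ∀ u : (κ → ℝ) → ℝ, u ∈ realPolynomialFunctions κ →
      (fun x : κ' → ℝ => u fun i => x (φ i)) ∈ realPolynomialFunctions κ' := by
    intro u hu
    obtain ⟨P, hP⟩ := mem_realPolynomialFunctions.mp hu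
    refine mem_realPolynomialFunctions.mpr ⟨MvPolynomial.rename φ P, fun x => ?_⟩
    rw [MvPolynomial.eval_rename, ← hP]
    rfl
  exact ⟨h _ hf.1, h _ hf.2⟩

end IsComplexPolynomial

/-! ### Genericity of separating linear maps. -/

namespace Reduction

open SepMonomials

variable {n k : ℕ}

/-- The matrix entries of `ℓ`. -/
noncomputable def entry (ℓ : Reduction n k) (c : Fin k) (e : Idx n) : ℂ :=
  ℓ (EuclideanSpace.single e 1) c

theorem apply_eq_sum (ℓ : Reduction n k) (v : Space n) (c : Fin k) :
    ℓ v c = ∑ e, v e * ℓ.entry c e := by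
  have hv : v = ∑ e, v e • EuclideanSpace.single e (1 : ℂ) := by
    ext e
    simp [Finset.sum_apply, Pi.single_apply, -Fintype.sum_sum_type]
  conv_lhs => rw [hv]
  simp [map_sum, entry, -Fintype.sum_sum_type]

/-- If `G` is a polynomial map of fewer than `2 k` real parameters, then a generic `ℓ` does not
annihilate any value of `G` whose `e`-th coordinate does not vanish. -/
theorem exists_polynomial_avoiding_coordinate {κ : Type} [Fintype κ]
    (hκ : Fintype.card κ < 2 * k) (G : (κ → ℝ) → Space n)
    (hG : ∀ e, IsComplexPolynomial fun p => G p e) (e : Idx n) :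
    ∃ Q : MvPolynomial ((Fin k × Idx n) × Bool) ℝ, Q ≠ 0 ∧
      ∀ ℓ : Reduction n k, MvPolynomial.eval ℓ.coords Q ≠ 0 →
        ∀ p, ℓ (G p) = 0 → G p e = 0 := by
  classical
  -- The bad `ℓ` are parametrized by `p` and `u`, where `u` stands for the entries off column `e`
  -- divided by `G p e`. This scaling keeps column `e`, solved from `ℓ (G p) = 0`, polynomial. Fewer
  -- than `2k` parameters replace the `2k` real entries of that column.
  let κ' : Type := κ ⊕ (({e' : Idx n // e' ≠ e} × Fin k) × Bool)
  let u : {e' : Idx n // e' ≠ e} → Fin k → (κ' → ℝ) → ℂ := fun e' c q =>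
    ⟨q (Sum.inr ((e', c), false)), q (Sum.inr ((e', c), true))⟩
  let M : Fin k → Idx n → (κ' → ℝ) → ℂ := fun c e' q =>
    if h : e' ≠ e then G (fun i => q (Sum.inl i)) e * u ⟨e', h⟩ c q
    else -∑ e'' : {e' : Idx n // e' ≠ e}, u e'' c q * G (fun i => q (Sum.inl i)) e''
  have hGq : ∀ e', IsComplexPolynomial fun q : κ' → ℝ => G (fun i => q (Sum.inl i)) e' :=
    fun e' => (hG e').comp_index Sum.inl
  have hu : ∀ e' c, IsComplexPolynomial (u e' c) := fun e' c =>
    IsComplexPolynomial.mk_coord _ _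
  have hM : ∀ c e', IsComplexPolynomial (M c e') := by
    intro c e'
    by_cases h : e' ≠ e
    · simpa only [M, dif_pos h] using (hGq e).mul (hu ⟨e', h⟩ c)
    · simp only [M, dif_neg h]
      exact (IsComplexPolynomial.sum _ fun e'' _ => (hu e'' c).mul (hGq e'')).neg
  have hcard : Fintype.card κ' < Fintype.card ((Fin k × Idx n) × Bool) := by
    have h1 : Fintype.card {e' : Idx n // e' ≠ e} + 1 = Fintype.card (Idx n) := by
      rw [Fintype.card_subtype_compl]
      have : 0 < Fintype.card (Idx n) := Fintype.card_pos_iff.mpr ⟨e⟩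
      simp only [Fintype.card_unique]
      omega
    simp only [κ', Fintype.card_sum, Fintype.card_prod, Fintype.card_bool, Fintype.card_fin,
      ← h1]
    nlinarith
  obtain ⟨Q, hQ0, hQ⟩ := exists_polynomial_relation hcard
    (fun b q => bif b.2 then (M b.1.1 b.1.2 q).im else (M b.1.1 b.1.2 q).re) (by
      rintro ⟨⟨c, e'⟩, _ | _⟩
      · exact (hM c e').1
      · exact (hM c e').2)
  refine ⟨Q, hQ0, fun ℓ hℓ p hp => ?_⟩
  by_contra hne
  let q : κ' → ℝ := Sum.elim p fun b =>
    bif b.2 then (ℓ.entry b.1.2 b.1.1 / G p e).im else (ℓ.entry b.1.2 b.1.1 / G p e).re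
  have hqu : ∀ e' c, u e' c q = ℓ.entry c e' / G p e := fun e' c => Complex.ext rfl rfl
  have hqp : (fun i => q (Sum.inl i)) = p := rfl
  have hMq : ∀ c e', M c e' q = ℓ.entry c e' := by
    intro c e'
    by_cases h : e' ≠ e
    · simp only [M, dif_pos h, hqu, hqp]
      rw [mul_div_cancel₀ _ hne]
    · simp only [M, dif_neg h, hqu, hqp]
      rw [not_not] at h
      subst h
      have h0 : ℓ (G p) c = 0 := by rw [hp]; rfl
      rw [apply_eq_sum, ← Finset.add_sum_erase _ _ (Finset.mem_univ e')] at h0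
      have h1 : ∑ e'' : {x : Idx n // x ≠ e'}, ℓ.entry c e'' / G p e' * G p e'' =
          (∑ x ∈ Finset.univ.erase e', G p x * ℓ.entry c x) / G p e' := by
        rw [Finset.sum_div, ← Finset.sum_subtype (Finset.univ.erase e') (by simp)
          (fun x => ℓ.entry c x / G p e' * G p x)]
        exact Finset.sum_congr rfl fun x _ => by ring
      rw [h1, ← neg_div, div_eq_iff hne]
      linear_combination -h0
  apply hℓ
  rw [← hQ q]
  congr 1
  congr 1
  funext b
  simp only [hMq]
  rfl

theorem exists_polynomial_avoiding {κ : Type} [Fintype κ]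
    (hκ : Fintype.card κ < 2 * k) (G : (κ → ℝ) → Space n)
    (hG : ∀ e, IsComplexPolynomial fun p => G p e) :
    ∃ Q : MvPolynomial ((Fin k × Idx n) × Bool) ℝ, Q ≠ 0 ∧
      ∀ ℓ : Reduction n k, MvPolynomial.eval ℓ.coords Q ≠ 0 →
        ∀ p, ℓ (G p) = 0 → G p = 0 := by
  choose Q hQ0 hQ using exists_polynomial_avoiding_coordinate hκ G hG
  refine ⟨∏ e, Q e, Finset.prod_ne_zero_iff.mpr fun e _ => hQ0 e, fun ℓ hℓ p hp => ?_⟩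
  rw [map_prod, Finset.prod_ne_zero_iff] at hℓ
  ext e
  exact hQ e ℓ (hℓ e (Finset.mem_univ e)) p hp

/-- A generic `ℓ` into dimension more than `2 n` annihilates no nonzero vector
`ρ F(x) - F(y)` with `ρ` real. -/
theorem exists_polynomial_separating (hk : 2 * n < k) (t : Fin n → ℂ) :
    ∃ Q : MvPolynomial ((Fin k × Idx n) × Bool) ℝ, Q ≠ 0 ∧
      ∀ ℓ : Reduction n k, MvPolynomial.eval ℓ.coords Q ≠ 0 →
        ∀ (ρ : ℝ) (x y : CSpace n), ℓ ((ρ : ℂ) • F t x - F t y) = 0 →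
          (ρ : ℂ) • F t x - F t y = 0 := by
  -- `none` carries `ρ`, and the rest the real coordinates of `x` and `y`: `4n + 1` parameters in
  -- all, fewer than `2k`. A complex `ρ` would not fit when `k = 2n + 1`.
  let κ : Type := Option (Bool × (Fin n × Bool))
  let X : Bool → (κ → ℝ) → CSpace n := fun s p =>
    WithLp.toLp 2 fun i => ⟨p (some (s, i, false)), p (some (s, i, true))⟩
  let G : (κ → ℝ) → Space n := fun p => (p none : ℂ) • F t (X false p) - F t (X true p)
  have hX : ∀ s i, IsComplexPolynomial fun p => X s p i := fun s i =>
    IsComplexPolynomial.mk_coord _ _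
  have hF : ∀ s e, IsComplexPolynomial fun p => F t (X s p) e := by
    rintro s (i | ⟨⟨i, j⟩, hij⟩)
    · exact (hX s i).pow _
    · exact ((hX s i).pow _).mul ((hX s j).pow _)
  have hG : ∀ e, IsComplexPolynomial fun p => G p e := by
    intro e
    have h := ((IsComplexPolynomial.ofReal_coord (none : κ)).mul (hF false e)).add (hF true e).neg
    simp only [← sub_eq_add_neg] at h
    exact h
  obtain ⟨Q, hQ0, hQ⟩ := exists_polynomial_avoiding (k := k) (κ := κ) (by
    simp only [κ, Fintype.card_option, Fintype.card_prod, Fintype.card_bool, Fintype.card_fin]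
    omega) G hG
  refine ⟨Q, hQ0, fun ℓ hℓ ρ x y h => ?_⟩
  let z : Bool → CSpace n := fun s => bif s then y else x
  let p : κ → ℝ := fun o => o.elim ρ fun b => bif b.2.2 then (z b.1 b.2.1).im else (z b.1 b.2.1).re
  have hXp : ∀ s, X s p = z s := fun s => by
    ext i
    exact Complex.ext rfl rfl
  have hGp : G p = (ρ : ℂ) • F t x - F t y := by
    simp only [G, hXp]
    rfl
  rw [← hGp] at h ⊢
  exact hQ ℓ hℓ p h

/-- The linear map with given real coordinates. -/
theorem exists_coords_eq (v : (Fin k × Idx n) × Bool → ℝ) : ∃ ℓ : Reduction n k, ℓ.coords = v := by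
  let L : Space n →ₗ[ℂ] CSpace k := (PiLp.basisFun 2 ℂ (Idx n)).constr ℂ fun e =>
    WithLp.toLp 2 fun c => (⟨v ((c, e), false), v ((c, e), true)⟩ : ℂ)
  refine ⟨LinearMap.toContinuousLinearMap L, ?_⟩
  have hL : ∀ e, L (EuclideanSpace.single e 1) =
      WithLp.toLp 2 fun c => (⟨v ((c, e), false), v ((c, e), true)⟩ : ℂ) := by
    intro e
    have h := (PiLp.basisFun 2 ℂ (Idx n)).constr_basis ℂ
      (fun e => (WithLp.toLp 2 fun c => (⟨v ((c, e), false), v ((c, e), true)⟩ : ℂ) : CSpace k)) e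
    rwa [PiLp.basisFun_apply] at h
  funext ⟨⟨c, e⟩, s⟩
  simp only [coords, LinearMap.coe_toContinuousLinearMap', hL]
  cases s <;> rfl

theorem coords_add_smul (ℓ η : Reduction n k) (s : ℝ) :
    (ℓ + (s : ℂ) • η).coords = ℓ.coords + s • η.coords := by
  funext ⟨⟨c, e⟩, b⟩
  cases b <;> simp [coords]

/-- Arbitrarily close to every `ℓ`, in a fixed direction, a nonzero polynomial is nonzero. -/
theorem exists_direction {Q : MvPolynomial ((Fin k × Idx n) × Bool) ℝ} (hQ : Q ≠ 0)
    (ℓ : Reduction n k) :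
    ∃ η : Reduction n k, ∀ δ > 0, ∃ s : ℝ, 0 < s ∧ s < δ ∧
      MvPolynomial.eval (ℓ + (s : ℂ) • η).coords Q ≠ 0 := by
  obtain ⟨v, hv⟩ : ∃ v, MvPolynomial.eval v Q ≠ 0 := by
    by_contra! h
    exact hQ (MvPolynomial.funext fun v => by rw [h, map_zero])
  -- The line from `ℓ` towards `v` meets a nonzero value of `Q` at `s = 1`, so `Q` restricts to a
  -- univariate polynomial with finitely many roots.
  obtain ⟨η, hη⟩ := exists_coords_eq (n := n) (k := k) (v - ℓ.coords)
  refine ⟨η, fun δ hδ => ?_⟩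
  let R : Polynomial ℝ := MvPolynomial.aeval
    (fun i => Polynomial.C (ℓ.coords i) + Polynomial.X * Polynomial.C (η.coords i)) Q
  have hR : ∀ s : ℝ, R.eval s = MvPolynomial.eval (ℓ + (s : ℂ) • η).coords Q := by
    intro s
    rw [coords_add_smul]
    have h1 := MvPolynomial.map_aeval
      (fun i => Polynomial.C (ℓ.coords i) + Polynomial.X * Polynomial.C (η.coords i))
      (Polynomial.evalRingHom s) Q
    rw [Polynomial.coe_evalRingHom] at h1
    refine h1.trans ?_
    have : (Polynomial.evalRingHom s).comp (algebraMap ℝ (Polynomial ℝ)) = RingHom.id ℝ := by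
      ext r
      simp
    rw [this]
    change MvPolynomial.eval _ Q = _
    congr 2
    funext i
    rw [Polynomial.eval_add, Polynomial.eval_mul, Polynomial.eval_C, Polynomial.eval_C,
      Polynomial.eval_X]
    rfl
  have hR0 : R ≠ 0 := by
    intro h0
    have h1 := hR 1
    rw [h0, Polynomial.eval_zero, coords_add_smul, hη] at h1
    apply hv
    rw [h1]
    congr 2
    simp
  obtain ⟨s, hs, hsR⟩ := ((Set.Ioo_infinite hδ).sdiff R.roots.toFinset.finite_toSet).nonempty
  refine ⟨s, hs.1, hs.2, ?_⟩
  rw [← hR]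
  intro h0
  exact hsR (by simp [hR0, h0])

end Reduction

/-! ### The homogenized map: separation and Lipschitz bounds. -/

namespace SepMonomials

variable {n : ℕ} {t : Fin n → ℂ}

theorem norm_pow_sub_pow_le {z w : ℂ} (hz : ‖z‖ ≤ 1) (hw : ‖w‖ ≤ 1) (a : ℕ) :
    ‖z ^ a - w ^ a‖ ≤ a * ‖z - w‖ := by
  induction a with
  | zero => simp
  | succ a ih =>
    have h : z ^ (a + 1) - w ^ (a + 1) = z ^ a * (z - w) + (z ^ a - w ^ a) * w := by ring
    rw [h]
    refine (norm_add_le _ _).trans ?_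
    rw [norm_mul, norm_mul, norm_pow]
    have h1 := mul_le_of_le_one_left (norm_nonneg (z - w)) (pow_le_one₀ (n := a) (norm_nonneg z) hz)
    have h2 := mul_le_of_le_one_right (norm_nonneg (z ^ a - w ^ a)) hw
    push_cast
    linarith

theorem norm_monomial_sub_le {z w z' w' : ℂ} (hz : ‖z‖ ≤ 1) (hw : ‖w‖ ≤ 1) (hz' : ‖z'‖ ≤ 1)
    (hw' : ‖w'‖ ≤ 1) (a b : ℕ) :
    ‖z ^ a * w ^ b - z' ^ a * w' ^ b‖ ≤ a * ‖z - z'‖ + b * ‖w - w'‖ := by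
  have h : z ^ a * w ^ b - z' ^ a * w' ^ b =
      (z ^ a - z' ^ a) * w ^ b + z' ^ a * (w ^ b - w' ^ b) := by ring
  rw [h]
  refine (norm_add_le _ _).trans (add_le_add ?_ ?_)
  · rw [norm_mul, norm_pow]
    exact (mul_le_of_le_one_right (norm_nonneg _) (pow_le_one₀ (norm_nonneg w) hw)).trans
      (norm_pow_sub_pow_le hz hz' a)
  · rw [norm_mul, norm_pow]
    exact (mul_le_of_le_one_left (norm_nonneg _) (pow_le_one₀ (norm_nonneg z') hz')).trans
      (norm_pow_sub_pow_le hw hw' b)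

/-- The unit vector in the direction of `x`, or `0` for `x = 0`. -/
noncomputable def unitVector (x : CSpace n) : CSpace n := (‖x‖ : ℂ)⁻¹ • x

theorem norm_unitVector {x : CSpace n} (hx : x ≠ 0) : ‖unitVector x‖ = 1 := by
  rw [unitVector, norm_smul, norm_inv, Complex.norm_real, norm_norm,
    inv_mul_cancel₀ (norm_ne_zero_iff.mpr hx)]

theorem norm_unitVector_le (x : CSpace n) : ‖unitVector x‖ ≤ 1 := by
  by_cases hx : x = 0
  · simp [unitVector, hx]
  · exact (norm_unitVector hx).le

theorem norm_unitVector_apply_le (x : CSpace n) (i : Fin n) : ‖unitVector x i‖ ≤ 1 :=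
  (PiLp.norm_apply_le _ i).trans (norm_unitVector_le x)

theorem norm_smul_unitVector (x : CSpace n) : (‖x‖ : ℂ) • unitVector x = x := by
  by_cases hx : x = 0
  · simp [unitVector, hx]
  · rw [unitVector, smul_smul, mul_inv_cancel₀ (by simpa using hx), one_smul]

/-- With `r = ‖x‖`, `s = ‖y‖` and `c` the real part of the inner product of the unit vectors, the
squares differ by `(s - r)² + 2r(s - r)(1 - c) ≥ 0`. -/
theorem norm_mul_norm_unitVector_sub_le {x y : CSpace n} (h : ‖x‖ ≤ ‖y‖) :
    ‖x‖ * ‖unitVector x - unitVector y‖ ≤ ‖x - y‖ := by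
  by_cases hx : x = 0
  · simp [hx]
  have hy : y ≠ 0 := by
    rintro rfl
    exact hx (norm_le_zero_iff.mp (by simpa using h))
  set u := unitVector x with hu
  set v := unitVector y with hv
  have hu1 : ‖u‖ = 1 := norm_unitVector hx
  have hv1 : ‖v‖ = 1 := norm_unitVector hy
  set r := ‖x‖ with hr
  set s := ‖y‖ with hs
  have hr0 : 0 ≤ r := norm_nonneg x
  have e1 : ‖x - y‖ ^ 2 = r ^ 2 + s ^ 2 - 2 * r * s * RCLike.re (inner ℂ u v) := by
    conv_lhs => rw [← norm_smul_unitVector x, ← norm_smul_unitVector y]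
    rw [← hu, ← hv, ← hr, ← hs, @norm_sub_sq ℂ, norm_smul, norm_smul, hu1, hv1,
      inner_smul_left, inner_smul_right]
    simp only [Complex.norm_real, Complex.conj_ofReal, Real.norm_eq_abs, mul_one, sq_abs]
    rw [← mul_assoc, ← Complex.ofReal_mul]
    have : RCLike.re (((r * s : ℝ) : ℂ) * inner ℂ u v) = r * s * RCLike.re (inner ℂ u v) :=
      Complex.re_ofReal_mul _ _
    rw [this]
    ring
  have e2 : ‖u - v‖ ^ 2 = 2 - 2 * RCLike.re (inner ℂ u v) := by
    rw [@norm_sub_sq ℂ, hu1, hv1]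
    ring
  have hc : RCLike.re (inner ℂ u v) ≤ 1 := by
    have := re_inner_le_norm (𝕜 := ℂ) u v
    rwa [hu1, hv1, one_mul] at this
  refine (sq_le_sq₀ (mul_nonneg hr0 (norm_nonneg _)) (norm_nonneg _)).mp ?_
  rw [mul_pow, e1, e2]
  nlinarith [mul_nonneg (mul_nonneg hr0 (sub_nonneg.mpr h)) (sub_nonneg.mpr hc),
    sq_nonneg (s - r)]

/-- The homogenization `x ↦ ‖x‖ F(x / ‖x‖)`. -/
noncomputable def homF (t : Fin n → ℂ) (x : CSpace n) : Space n :=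
  (‖x‖ : ℂ) • F t (unitVector x)

theorem normalized_apply {k : ℕ} (ℓ : Reduction n k) (x : CSpace n) :
    normalized (fun y => ℓ (F t y)) x = ℓ (homF t x) := by
  unfold normalized homF unitVector
  split_ifs with h
  · simp [h]
  · rw [map_smul]

/-- If `‖x‖ < ‖y‖`, the pure powers make every nonzero coordinate of `unitVector y` strictly smaller
in modulus than that of `unitVector x`, so the former could not have norm `1`. -/
theorem norm_le_of_homF_eq {x y : CSpace n} (h : homF t x = homF t y) : ‖y‖ ≤ ‖x‖ := by
  by_contra! hlt
  have hy : y ≠ 0 := by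
    rintro rfl
    rw [norm_zero] at hlt
    exact absurd hlt (not_lt.mpr (norm_nonneg x))
  have hpure : ∀ i, ‖x‖ * ‖unitVector x i‖ ^ orderOf (t i) =
      ‖y‖ * ‖unitVector y i‖ ^ orderOf (t i) := by
    intro i
    have h1 : (‖x‖ : ℂ) * unitVector x i ^ orderOf (t i) =
        ‖y‖ * unitVector y i ^ orderOf (t i) :=
      congrArg (fun v : Space n => v (Sum.inl i)) h
    simpa using congrArg norm h1
  have hstrict : ∀ i, unitVector y i ≠ 0 → ‖unitVector y i‖ < ‖unitVector x i‖ := by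
    intro i hi
    by_contra! hle
    have h1 : ‖x‖ * ‖unitVector x i‖ ^ orderOf (t i) ≤ ‖x‖ * ‖unitVector y i‖ ^ orderOf (t i) := by
      gcongr
    have h2 : ‖x‖ * ‖unitVector y i‖ ^ orderOf (t i) < ‖y‖ * ‖unitVector y i‖ ^ orderOf (t i) :=
      mul_lt_mul_of_pos_right hlt (pow_pos (norm_pos_iff.mpr hi) _)
    exact absurd (hpure i) (h1.trans_lt h2).ne
  have hle : ∀ i, ‖unitVector y i‖ ≤ ‖unitVector x i‖ := by
    intro i
    by_cases hi : unitVector y i = 0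
    · rw [hi, norm_zero]
      exact norm_nonneg _
    · exact (hstrict i hi).le
  obtain ⟨i, hi⟩ : ∃ i, unitVector y i ≠ 0 := by
    by_contra! h0
    have : unitVector y = 0 := by
      ext i
      exact h0 i
    have h1 := norm_unitVector hy
    rw [this, norm_zero] at h1
    exact zero_ne_one h1
  have hsum : ‖unitVector y‖ ^ 2 < ‖unitVector x‖ ^ 2 := by
    rw [EuclideanSpace.norm_sq_eq, EuclideanSpace.norm_sq_eq]
    refine Finset.sum_lt_sum (fun j _ => ?_) ⟨i, Finset.mem_univ i, ?_⟩
    · exact pow_le_pow_left₀ (norm_nonneg _) (hle j) 2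
    · exact pow_lt_pow_left₀ (hstrict i hi) (norm_nonneg _) two_ne_zero
  rw [norm_unitVector hy] at hsum
  have := pow_le_one₀ (n := 2) (norm_nonneg _) (norm_unitVector_le x)
  linarith

section

variable (ht : ∀ i, 0 < orderOf (t i))
include ht

theorem homF_pow_smul {x y : CSpace n} {c : ℕ} (hn : ‖y‖ = ‖x‖) (h : ∀ i, y i = t i ^ c * x i) :
    homF t y = homF t x := by
  unfold homF
  rw [hn]
  congr 1
  refine F_pow_smul ht (c := c) fun i => ?_
  simp only [unitVector, hn, PiLp.smul_apply, smul_eq_mul, h]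
  ring

/-- The homogenized map separates the orbits of the diagonal action. -/
theorem exists_pow_of_homF_eq {x y : CSpace n} (h : homF t y = homF t x) :
    ∃ c : ℕ, ∀ i, y i = t i ^ c * x i := by
  have hn : ‖y‖ = ‖x‖ := le_antisymm (norm_le_of_homF_eq h.symm) (norm_le_of_homF_eq h)
  by_cases hx : x = 0
  · have hy : y = 0 := by
      rw [hx, norm_zero] at hn
      exact norm_eq_zero.mp hn
    exact ⟨0, fun i => by simp [hx, hy]⟩
  have hr : (‖x‖ : ℂ) ≠ 0 := by simpa using hx
  unfold homF at h
  rw [hn] at h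
  obtain ⟨c, hc⟩ := exists_pow_of_F_eq ht (smul_right_injective _ hr h)
  refine ⟨c, fun i => ?_⟩
  rw [← norm_smul_unitVector x, ← norm_smul_unitVector y, hn, PiLp.smul_apply, PiLp.smul_apply,
    hc, smul_eq_mul, smul_eq_mul]
  ring

/-- Every coordinate of the homogenized map is Lipschitz with constant `2 m`. -/
theorem norm_homF_sub_apply_le {m : ℕ} (hm : ∀ i, orderOf (t i) ≤ m) (x y : CSpace n) (e : Idx n) :
    ‖(homF t x - homF t y) e‖ ≤ 2 * m * ‖x - y‖ := by
  wlog h : ‖x‖ ≤ ‖y‖ generalizing x y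
  · have := this y x (le_of_not_ge h)
    rw [← neg_sub (homF t y), norm_sub_rev x y, PiLp.neg_apply, norm_neg]
    exact this
  have hdiff : ∀ i, ‖x‖ * ‖unitVector x i - unitVector y i‖ ≤ ‖x - y‖ := fun i =>
    (mul_le_mul_of_nonneg_left (PiLp.norm_apply_le (unitVector x - unitVector y) i)
      (norm_nonneg x)).trans (norm_mul_norm_unitVector_sub_le h)
  have hrs : ‖y‖ - ‖x‖ ≤ ‖x - y‖ := by
    rw [norm_sub_rev]
    exact norm_sub_norm_le y x
  -- Strictness of `b < m_k` keeps the degree at most `2m - 1`; the spare unit pays for the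
  -- variation of the norm factor.
  obtain ⟨i, j, a, b, hab, hF⟩ : ∃ (i j : Fin n) (a b : ℕ), a + b + 1 ≤ 2 * m ∧
      ∀ z : CSpace n, F t z e = z i ^ a * z j ^ b := by
    rcases e with i | ⟨⟨i, j⟩, hij⟩
    · refine ⟨i, i, orderOf (t i), 0, ?_, fun z => by simp [F]⟩
      have := hm i
      have := ht i
      omega
    · refine ⟨i, j, expA t i j, expB t i j, ?_, fun z => rfl⟩
      have := hm i
      have := hm j
      have := expA_le_orderOf ht i j
      have := (expB_spec ht i j).1
      omega
  have hsplit : (homF t x - homF t y) e =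
      (‖x‖ : ℂ) * (unitVector x i ^ a * unitVector x j ^ b
        - unitVector y i ^ a * unitVector y j ^ b)
      - ((‖y‖ - ‖x‖ : ℝ) : ℂ) * (unitVector y i ^ a * unitVector y j ^ b) := by
    rw [PiLp.sub_apply, homF, homF, PiLp.smul_apply, PiLp.smul_apply, hF, hF, smul_eq_mul,
      smul_eq_mul]
    push_cast
    ring
  have h1 : ‖(‖x‖ : ℂ) * (unitVector x i ^ a * unitVector x j ^ b
      - unitVector y i ^ a * unitVector y j ^ b)‖ ≤ (a + b) * ‖x - y‖ := by
    rw [norm_mul, Complex.norm_real, norm_norm]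
    have := norm_monomial_sub_le (norm_unitVector_apply_le x i) (norm_unitVector_apply_le x j)
      (norm_unitVector_apply_le y i) (norm_unitVector_apply_le y j) a b
    refine (mul_le_mul_of_nonneg_left this (norm_nonneg x)).trans ?_
    have ha := mul_le_mul_of_nonneg_left (hdiff i) (Nat.cast_nonneg (α := ℝ) a)
    have hb := mul_le_mul_of_nonneg_left (hdiff j) (Nat.cast_nonneg (α := ℝ) b)
    linarith
  have h2 : ‖((‖y‖ - ‖x‖ : ℝ) : ℂ) * (unitVector y i ^ a * unitVector y j ^ b)‖ ≤ ‖x - y‖ := by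
    rw [norm_mul, Complex.norm_real, Real.norm_of_nonneg (sub_nonneg.mpr h), norm_mul, norm_pow,
      norm_pow]
    have hle : ‖unitVector y i‖ ^ a * ‖unitVector y j‖ ^ b ≤ 1 :=
      mul_le_one₀ (pow_le_one₀ (norm_nonneg _) (norm_unitVector_apply_le y i))
        (pow_nonneg (norm_nonneg _) _)
        (pow_le_one₀ (norm_nonneg _) (norm_unitVector_apply_le y j))
    exact (mul_le_of_le_one_right (sub_nonneg.mpr h) hle).trans hrs
  have hab' : (a : ℝ) + b + 1 ≤ 2 * m := by exact_mod_cast hab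
  rw [hsplit]
  have h3 := mul_le_mul_of_nonneg_right hab' (norm_nonneg (x - y))
  have h4 := norm_sub_le ((‖x‖ : ℂ) * (unitVector x i ^ a * unitVector x j ^ b
      - unitVector y i ^ a * unitVector y j ^ b))
    (((‖y‖ - ‖x‖ : ℝ) : ℂ) * (unitVector y i ^ a * unitVector y j ^ b))
  linarith

end

end SepMonomials

/-! ### Passage to the orbit space. -/

namespace Reduction

open SepMonomials

variable {n k : ℕ} {t : Fin n → ℂ}

theorem norm_apply_le_supOpNorm (ℓ : Reduction n k) {v : Space n} {C : ℝ} (hC : 0 ≤ C)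
    (hv : ∀ e, ‖v e‖ ≤ C) : ‖ℓ v‖ ≤ ℓ.supOpNorm * C := by
  have h1 := (ℓ.comp (PiLp.continuousLinearEquiv 2 ℂ
    (fun _ : SepMonomials.Idx n => ℂ)).symm.toContinuousLinearMap).le_opNorm
      (fun e => v e)
  refine h1.trans (mul_le_mul_of_nonneg_left ?_ (norm_nonneg _))
  exact (pi_norm_le_iff_of_nonneg hC).mpr hv

/-- `ℓ` is injective on the real cone spanned by the image of `F`, in the sense needed for both
`ℓ ∘ F` and its homogenization. -/
def Separates (t : Fin n → ℂ) (ℓ : Reduction n k) : Prop :=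
  ∀ (ρ : ℝ) (x y : CSpace n), ℓ ((ρ : ℂ) • F t x - F t y) = 0 → (ρ : ℂ) • F t x - F t y = 0

theorem Separates.F_eq {ℓ : Reduction n k} (hℓ : ℓ.Separates t) {x y : CSpace n}
    (h : ℓ (F t x) = ℓ (F t y)) : F t x = F t y := by
  have := hℓ 1 x y (by rw [Complex.ofReal_one, one_smul, map_sub, h, sub_self])
  rwa [Complex.ofReal_one, one_smul, sub_eq_zero] at this

theorem Separates.homF_eq {ℓ : Reduction n k} (hℓ : ℓ.Separates t) {x y : CSpace n}
    (h : ℓ (homF t x) = ℓ (homF t y)) : homF t x = homF t y := by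
  by_cases hy : y = 0
  · by_cases hx : x = 0
    · rw [hx, hy]
    have hx' : (‖x‖ : ℂ) ≠ 0 := by simpa using hx
    have h1 : homF t y = 0 := by simp [homF, hy]
    rw [h1, map_zero, homF, map_smul, smul_eq_zero] at h
    -- Taking `ρ = 0` says that `ℓ` kills no nonzero value of `F`; the first vector is a dummy.
    have h2 := hℓ 0 x (unitVector x) (by simp [h.resolve_left hx'])
    rw [Complex.ofReal_zero, zero_smul, zero_sub, neg_eq_zero] at h2
    rw [h1, homF, h2, smul_zero]
  · have hy' : (‖y‖ : ℂ) ≠ 0 := by simpa using hy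
    have key : homF t x - homF t y =
        (‖y‖ : ℂ) • (((‖x‖ / ‖y‖ : ℝ) : ℂ) • F t (unitVector x) - F t (unitVector y)) := by
      rw [smul_sub, smul_smul, homF, homF, Complex.ofReal_div, mul_div_cancel₀ _ hy']
    rw [← sub_eq_zero, ← map_sub, key, map_smul, smul_eq_zero] at h
    rw [← sub_eq_zero, key, hℓ _ _ _ (h.resolve_left hy'), smul_zero]

end Reduction

namespace UnitaryAction

open SepMonomials Reduction

variable {m n k : ℕ} {σ : UnitaryAction (Multiplicative (ZMod m)) n}
  {b : OrthonormalBasis (Fin n) ℂ (CSpace n)} {t : Fin n → ℂ}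

theorem IsDiagonalIn.orderOf_pos (hσ : σ.IsDiagonalIn b t) (hm : 1 ≤ m) (i : Fin n) :
    0 < orderOf (t i) :=
  orderOf_pos_iff.mpr (isOfFinOrder_iff_pow_eq_one.mpr ⟨m, hm, hσ.pow_eq_one i⟩)

theorem IsDiagonalIn.orderOf_le (hσ : σ.IsDiagonalIn b t) (hm : 1 ≤ m) (i : Fin n) :
    orderOf (t i) ≤ m :=
  orderOf_le_of_pow_eq_one hm (hσ.pow_eq_one i)

/-- A function of the coordinates whose level sets are the orbits of the powers of
`diag(t₁, …, tₙ)` induces an injective map on the orbit space. -/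
theorem IsDiagonalIn.inducesInjective (hσ : σ.IsDiagonalIn b t) (hm : 1 ≤ m) {W : Type}
    {Φ : CSpace n → W}
    (hinv : ∀ (x y : CSpace n) (c : ℕ), ‖y‖ = ‖x‖ → (∀ i, y i = t i ^ c * x i) → Φ y = Φ x)
    (hsep : ∀ x y : CSpace n, Φ y = Φ x → ∃ c : ℕ, ∀ i, y i = t i ^ c * x i) :
    σ.InducesInjective fun x => Φ (b.repr x) := by
  refine ⟨fun g x => ?_, ?_⟩
  · obtain ⟨c, rfl⟩ := ZMod.exists_pow_ofAdd_one hm g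
    refine hinv _ _ c ?_ (hσ.repr_apply c x)
    rw [b.repr.norm_map, b.repr.norm_map, LinearIsometryEquiv.norm_map]
  · rintro ⟨x⟩ ⟨y⟩ h
    obtain ⟨c, hc⟩ := hsep _ _ h
    refine Quotient.sound ⟨Multiplicative.ofAdd 1 ^ c, b.repr.injective ?_⟩
    ext i
    rw [hc, hσ.repr_apply]

theorem IsDiagonalIn.inducesInjective_reducedMap (hσ : σ.IsDiagonalIn b t) (hm : 1 ≤ m)
    {ℓ : Reduction n k} (hℓ : ℓ.Separates t) : σ.InducesInjective (reducedMap b t ℓ) :=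
  hσ.inducesInjective hm (Φ := fun x => ℓ (F t x))
    (fun _ _ _ _ h => congrArg ℓ (F_pow_smul (hσ.orderOf_pos hm) h))
    (fun _ _ h => exists_pow_of_F_eq (hσ.orderOf_pos hm) (hℓ.F_eq h))

theorem repMap_eq (ℓ : Reduction n k) : repMap b t ℓ = fun x => ℓ (homF t (b.repr x)) :=
  funext fun x => normalized_apply ℓ (b.repr x)

theorem IsDiagonalIn.inducesInjective_repMap (hσ : σ.IsDiagonalIn b t) (hm : 1 ≤ m)
    {ℓ : Reduction n k} (hℓ : ℓ.Separates t) : σ.InducesInjective (repMap b t ℓ) := by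
  rw [repMap_eq]
  exact hσ.inducesInjective hm (Φ := fun x => ℓ (homF t x))
    (fun _ _ _ hn h => congrArg ℓ (homF_pow_smul (hσ.orderOf_pos hm) hn h))
    (fun _ _ h => exists_pow_of_homF_eq (hσ.orderOf_pos hm) (hℓ.homF_eq h))

/-- A bound for `ℓ` on vectors whose coordinates are at most `2 m d` gives a Lipschitz bound. -/
theorem IsDiagonalIn.inducesLipschitz_repMap (hσ : σ.IsDiagonalIn b t) (hm : 1 ≤ m)
    {ℓ : Reduction n k} {C : ℝ}
    (hC : ∀ (v : Space n) (d : ℝ), 0 ≤ d → (∀ e, ‖v e‖ ≤ 2 * m * d) → ‖ℓ v‖ ≤ C * d) :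
    σ.InducesLipschitz (repMap b t ℓ) C := by
  have : NeZero m := ⟨by omega⟩
  have hinv : σ.IsInvariant (repMap b t ℓ) := by
    rw [repMap_eq]
    intro g x
    obtain ⟨c, rfl⟩ := ZMod.exists_pow_ofAdd_one hm g
    refine congrArg ℓ (homF_pow_smul (hσ.orderOf_pos hm) ?_ (hσ.repr_apply c x))
    rw [b.repr.norm_map, b.repr.norm_map, LinearIsometryEquiv.norm_map]
  refine ⟨hinv, ?_⟩
  rintro ⟨x⟩ ⟨y⟩
  have : Finite (Multiplicative (ZMod m)) := inferInstanceAs (Finite (ZMod m))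
  -- By invariance `y` may be replaced by its translate nearest to `x`.
  obtain ⟨g, hg⟩ := exists_eq_ciInf_of_finite (f := fun g => ‖x - σ g y‖)
  change ‖repMap b t ℓ x - repMap b t ℓ y‖ ≤ C * ⨅ g, ‖x - σ g y‖
  rw [← hg, ← hinv g y, repMap_eq, ← map_sub]
  refine hC _ _ (norm_nonneg _) fun e => ?_
  have := norm_homF_sub_apply_le (hσ.orderOf_pos hm) (hσ.orderOf_le hm) (b.repr x)
    (b.repr (σ g y)) e
  rwa [← map_sub, b.repr.norm_map] at this

end UnitaryAction

/-! ### A linear map with Lipschitz constant independent of `n`. -/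

namespace Reduction

open SepMonomials

variable {n k : ℕ}

/-- Half the projection to the pure power of the first coordinate. -/
noncomputable def halfProj (n k : ℕ) [NeZero n] [NeZero k] : Reduction n k :=
  (EuclideanSpace.proj (Sum.inl 0 : Idx n) : Space n →L[ℂ] ℂ).smulRight
    (EuclideanSpace.single (0 : Fin k) (1 / 2 : ℂ))

theorem norm_halfProj_apply [NeZero n] [NeZero k] (v : Space n) :
    ‖halfProj n k v‖ = 1 / 2 * ‖v (Sum.inl 0)‖ := by
  simp [halfProj, norm_smul, mul_comm]

theorem norm_halfProj [NeZero n] [NeZero k] : ‖halfProj n k‖ = 1 / 2 := by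
  refine le_antisymm (ContinuousLinearMap.opNorm_le_bound _ (by norm_num) fun v => ?_) ?_
  · rw [norm_halfProj_apply]
    exact mul_le_mul_of_nonneg_left (PiLp.norm_apply_le v _) (by norm_num)
  · have h := (halfProj n k).le_opNorm (EuclideanSpace.single (Sum.inl 0) 1)
    rw [norm_halfProj_apply] at h
    simpa using h

end Reduction

theorem mainTheorem1 (m n : ℕ) (hm : 1 ≤ m)
    (σ : UnitaryAction (Multiplicative (ZMod m)) n) :
    (∃ (b : OrthonormalBasis (Fin n) ℂ (CSpace n)) (t : Fin n → ℂ), σ.IsDiagonalIn b t) ∧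
    ∀ (b : OrthonormalBasis (Fin n) ℂ (CSpace n)) (t : Fin n → ℂ), σ.IsDiagonalIn b t →
      Reduction.Generic (fun ℓ : Reduction n (2 * n + 1) =>
        σ.InducesInjective (reducedMap b t ℓ) ∧
        σ.InducesInjective (repMap b t ℓ) ∧
        σ.InducesLipschitz (repMap b t ℓ) (3 * m * ℓ.supOpNorm)) ∧
      ∃ ℓ : Reduction n (2 * n + 1), ‖ℓ‖ ≤ 1 ∧
        σ.InducesInjective (reducedMap b t ℓ) ∧
        σ.InducesInjective (repMap b t ℓ) ∧
        σ.InducesLipschitz (repMap b t ℓ) (3 * m * ‖ℓ‖) := by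
  refine ⟨σ.exists_isDiagonalIn hm, fun b t hσ => ?_⟩
  obtain ⟨Q, hQ0, hQ⟩ :=
    Reduction.exists_polynomial_separating (k := 2 * n + 1) (Nat.lt_succ_self _) t
  have hm1 : (1 : ℝ) ≤ m := by exact_mod_cast hm
  refine ⟨⟨Q, hQ0, fun ℓ hℓ => ⟨hσ.inducesInjective_reducedMap hm (hQ ℓ hℓ),
    hσ.inducesInjective_repMap hm (hQ ℓ hℓ), hσ.inducesLipschitz_repMap hm ?_⟩⟩, ?_⟩
  · intro v d hd hv
    have h0 : 0 ≤ ℓ.supOpNorm := norm_nonneg _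
    refine (ℓ.norm_apply_le_supOpNorm (by positivity) hv).trans ?_
    have : 0 ≤ m * d * ℓ.supOpNorm := by positivity
    linarith
  · rcases Nat.eq_zero_or_pos n with rfl | hn
    -- For `n = 0` there is no coordinate to project to, but all spaces of monomials are trivial.
    · have hsep : Reduction.Separates t (0 : Reduction 0 (2 * 0 + 1)) :=
        fun ρ x y _ => Subsingleton.elim _ _
      refine ⟨0, by simp, hσ.inducesInjective_reducedMap hm hsep,
        hσ.inducesInjective_repMap hm hsep, hσ.inducesLipschitz_repMap hm fun v d hd _ => ?_⟩
      simp
    · have : NeZero n := ⟨hn.ne'⟩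
      set p := Reduction.halfProj n (2 * n + 1) with hp
      have hp1 : ‖p‖ = 1 / 2 := Reduction.norm_halfProj
      obtain ⟨η, hη⟩ := Reduction.exists_direction hQ0 p
      have hS : 0 ≤ η.supOpNorm := norm_nonneg _
      -- The final estimate needs `1 + 2sS ≤ 3‖ℓ‖` with `S = η.supOpNorm`. Since `‖ℓ‖ ≥ 1/2 - s‖η‖`,
      -- it suffices that `4sS + 6s‖η‖ ≤ 1`; this also gives `‖ℓ‖ ≤ 1`. The summand `1` makes `K`
      -- positive.
      set K := 4 * η.supOpNorm + 6 * ‖η‖ + 1 with hK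
      have hK0 : 0 < K := by positivity
      obtain ⟨s, hs0, hsK, hs⟩ := hη K⁻¹ (inv_pos.mpr hK0)
      have hsK1 : s * K < 1 := by
        rwa [← one_div, lt_div_iff₀ hK0] at hsK
      have hsS : 0 ≤ s * η.supOpNorm := by positivity
      have hsη : 0 ≤ s * ‖η‖ := by positivity
      have hsum : 4 * (s * η.supOpNorm) + 6 * (s * ‖η‖) < 1 := by
        rw [hK] at hsK1
        linarith
      have hnorm : ‖(s : ℂ) • η‖ = s * ‖η‖ := by
        rw [norm_smul, Complex.norm_real, Real.norm_of_nonneg hs0.le]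
      set ℓ := p + (s : ℂ) • η with hℓ
      have hsep : Reduction.Separates t ℓ := hQ ℓ hs
      have hup : ‖ℓ‖ ≤ 1 / 2 + s * ‖η‖ := by
        have := norm_add_le p ((s : ℂ) • η)
        rwa [hnorm, hp1] at this
      have hlow : 1 / 2 - s * ‖η‖ ≤ ‖ℓ‖ := by
        have := norm_sub_le ℓ ((s : ℂ) • η)
        rw [hℓ, add_sub_cancel_right, hp1, hnorm] at this
        linarith
      refine ⟨ℓ, by linarith, hσ.inducesInjective_reducedMap hm hsep,
        hσ.inducesInjective_repMap hm hsep, hσ.inducesLipschitz_repMap hm fun v d hd hv => ?_⟩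
      have h1 : ‖p v‖ ≤ m * d := by
        rw [hp, Reduction.norm_halfProj_apply]
        linarith [hv (Sum.inl 0)]
      have h2 : ‖((s : ℂ) • η) v‖ ≤ s * (η.supOpNorm * (2 * m * d)) := by
        rw [smul_apply, norm_smul, Complex.norm_real,
          Real.norm_of_nonneg hs0.le]
        exact mul_le_mul_of_nonneg_left (η.norm_apply_le_supOpNorm (by positivity) hv) hs0.le
      have h3 : ‖ℓ v‖ ≤ ‖p v‖ + ‖((s : ℂ) • η) v‖ := norm_add_le _ _
      have hmd : 0 ≤ m * d := by positivity
      have h4 : m * d * (1 + 2 * (s * η.supOpNorm)) ≤ m * d * (3 * ‖ℓ‖) :=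
        mul_le_mul_of_nonneg_left (by linarith) hmd
      linarith
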